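/- Let $d\ge 3$, let $\Omega\subset\mathbb R^d$ be a bounded Lipschitz domain, and put $H=L^2(\Omega,\mathbb R^d)$ with norm $\|\cdot\|$ and inner product $\langle\cdot,\cdot\rangle$, and $E=H^1(\Omega,\mathbb R^d)$ with $\|u\|_E^2=\|\nabla u\|^2+\|u\|^2$. Consider the evolutionary equation $$\frac{dg}{dt}+\mathcal A g=f(g),\qquad (1)$$ where $f\in C^1(\mathbb R^d,\mathbb R^d)$ acts pointwise, $(f(g))(x)=f(g(x))$, and $\mathcal A:\mathscr D(\mathcal A)\to H$ is a densely defined, nonnegative, self-adjoint operator with compact resolvent. The space $E$ is related to $\mathcal A$ as follows: $\mathscr D(\mathcal A)\subset E$, and there is a constant $\kappa$ with $\|u\|_E^2\le\kappa\,(\langle\mathcal A u,u\rangle+\|u\|^2)$ for all $u\in\mathscr D(\mathcal A)$. Let $\{e_i\}_{i\ge1}$ be a complete orthonormal sequence of eigenvectors, $\mathcal A e_i=\lambda_i e_i$ with $\lambda_i\le\lambda_{i+1}$, and let $P_m$ be the orthogonal projection of $H$ onto $\mathrm{Span}\{e_1,\dots,e_m\}$. A weak solution of (1) is a function $g\in C([0,\infty),H)\cap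 L^2_{\rm loc}([0,\infty),E)$ such that for every $\zeta\in\mathscr D(\mathcal A)$ the function $f(g(t))\cdot\zeta$ is integrable over $\Omega$ for a.e. $t$, the function $(f(g(\cdot)),\zeta)=\int_\Omega f(g(\cdot))\cdot\zeta\,dx$ is locally integrable on $[0,\infty)$, and $\frac{d}{dt}\langle g,\zeta\rangle=-\langle g,\mathcal A\zeta\rangle+(f(g),\zeta)$, that is, $$\langle g(t),\zeta\rangle-\langle g(0),\zeta\rangle=\int_0^t\big(-\langle g(s),\mathcal A\zeta\rangle+(f(g(s)),\zeta)\big)\,ds,\qquad t\ge0.$$ Assume that weak solutions exist on $[0,\infty)$ for all initial data in $H$ and form a semiflow $\{S(t)\}_{t\ge0}$ on $H$: $S(0)=I$, $S(s+t)=S(s)S(t)$ for $s,t\ge 0$, and $t\mapsto S(t)g_0$ is a weak solution for every $g_0\in H$. Let $M\subset E$ be closed and bounded in $E$ and positively invariant ($S(t)M\subset M$ for all $t\ge0$), and suppose that there are constants $C,C^*>0$ such that for all $g,\tilde g\in M$ $$\|f(g)-f(\tilde g)\|\le C\|g-\tilde g\|_E,\qquad \langle f(g)-f(\tilde g),\,g-\tilde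 g\rangle\le C^*\|g-\tilde g\|^2.$$ Then there is an integer $m_0\ge1$ such that for every $m\ge m_0$ the time-one map $S=S(1)$ has the squeezing property on $M$ with respect to the finite-rank orthogonal projection $P=P_m$: there is a constant $\delta\in(0,1)$ such that for every pair $g,h\in M$ $$\|Sg-Sh\|\le\delta\|g-h\|\qquad\text{or}\qquad \|(I-P)(Sg-Sh)\|\le\|P(Sg-Sh)\|.$$ -/

import Mathlib

open MeasureTheory Set Filter Topology
open scoped ContDiff RealInnerProductSpace

noncomputable section

/-! ### Domains and function spaces -/

/-- The Euclidean space `ℝ^d`. -/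
abbrev Euc (d : ℕ) : Type := EuclideanSpace ℝ (Fin d)

/-- `Ω` is a bounded Lipschitz domain: nonempty, open, connected, bounded, and near every boundary
point it is, for some unit vector `ν`, the part of the space lying strictly above (in the direction
`ν`) the graph of a Lipschitz function `φ` of the components orthogonal to `ν`. -/
structure IsBoundedLipschitzDomain {d : ℕ} (Ω : Set (Euc d)) : Prop where
  isOpen : IsOpen Ω
  isConnected : IsConnected Ω
  isBounded : Bornology.IsBounded Ω
  lipschitz_boundary : ∀ x ∈ frontier Ω, ∃ r : ℝ, 0 < r ∧ ∃ ν : Euc d, ‖ν‖ = 1 ∧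
    ∃ (K : NNReal) (φ : Euc d → ℝ), LipschitzWith K φ ∧
      ∀ y ∈ Metric.ball x r, (y ∈ Ω ↔ φ (y - ⟪y, ν⟫ • ν) < ⟪y, ν⟫)

/-- The Hilbert space `H = L²(Ω, ℝ^d)`. -/
abbrev L2 {d : ℕ} (Ω : Set (Euc d)) : Type := Lp (Euc d) 2 (volume.restrict Ω)

/-- `v ∈ L²(Ω, ℝ^d)` is the weak partial derivative `∂u/∂x_i` of `u ∈ L²(Ω, ℝ^d)` in `Ω`:
`∫_Ω (∂φ/∂x_i) u dx = - ∫_Ω φ v dx` for every test function `φ ∈ C_c^∞(Ω)`. -/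
def HasWeakPartial {d : ℕ} {Ω : Set (Euc d)} (i : Fin d) (u v : L2 Ω) : Prop :=
  ∀ φ : Euc d → ℝ, ContDiff ℝ ∞ φ → HasCompactSupport φ → tsupport φ ⊆ Ω →
    ∫ x in Ω, (fderiv ℝ φ x (EuclideanSpace.single i 1)) • u x = - ∫ x in Ω, φ x • v x

/-- `u` belongs to the Sobolev space `E = H¹(Ω, ℝ^d)`. -/
def MemH1 {d : ℕ} {Ω : Set (Euc d)} (u : L2 Ω) : Prop :=
  ∀ i : Fin d, ∃ v : L2 Ω, HasWeakPartial i u v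

open Classical in
/-- The weak partial derivative `∂u/∂x_i` (and `0` if it does not exist in `L²`). -/
def weakPartial {d : ℕ} {Ω : Set (Euc d)} (i : Fin d) (u : L2 Ω) : L2 Ω :=
  if h : ∃ v : L2 Ω, HasWeakPartial i u v then h.choose else 0

/-- The norm of `E`: `‖u‖_E² = ‖∇u‖² + ‖u‖²`. It is used only for `u` with `MemH1 u`. -/
def normE {d : ℕ} {Ω : Set (Euc d)} (u : L2 Ω) : ℝ :=
  Real.sqrt ((∑ i : Fin d, ‖weakPartial i u‖ ^ 2) + ‖u‖ ^ 2)

/-- `M` is a closed and bounded subset of the space `E`, for the norm of `E`. -/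
structure IsClosedBoundedInE {d : ℕ} {Ω : Set (Euc d)} (M : Set (L2 Ω)) : Prop where
  subset_E : ∀ u ∈ M, MemH1 u
  closed : ∀ (w : ℕ → L2 Ω) (u : L2 Ω), (∀ n, w n ∈ M) → MemH1 u →
    Tendsto (fun n => normE (w n - u)) atTop (𝓝 0) → u ∈ M
  bounded : ∃ R : ℝ, ∀ u ∈ M, normE u ≤ R

/-! ### The operator -/

section Operator

variable {H : Type*} [NormedAddCommGroup H] [InnerProductSpace ℝ H]

/-- Compact resolvent: for some real `μ` the operator `A - μ`, defined on the domain of `A`, has a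
bounded everywhere defined inverse `R`, and `R` is a compact operator. -/
def HasCompactResolvent (A : H →ₗ.[ℝ] H) : Prop :=
  ∃ (μ : ℝ) (R : H →L[ℝ] H), IsCompactOperator R ∧
    (∀ y : H, ∃ h : R y ∈ A.domain, A ⟨R y, h⟩ - μ • R y = y) ∧
    ∀ x : A.domain, R (A x - μ • (x : H)) = x

/-- A densely defined, nonnegative, self-adjoint operator with compact resolvent. -/
structure IsNonnegSelfAdjointCompactResolvent [CompleteSpace H] (A : H →ₗ.[ℝ] H) : Prop where
  dense : Dense (A.domain : Set H)
  selfAdjoint : IsSelfAdjoint A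
  nonneg : ∀ x : A.domain, 0 ≤ ⟪A x, (x : H)⟫
  compactResolvent : HasCompactResolvent A

/-- `e` is a complete orthonormal sequence of eigenvectors of `A`, whose eigenvalues `lam i`
(repeated according to multiplicity) are arranged in nondecreasing order. -/
structure IsOrderedEigenbasis (A : H →ₗ.[ℝ] H) (e : HilbertBasis ℕ ℝ H) (lam : ℕ → ℝ) : Prop where
  mono : Monotone lam
  eigen : ∀ i : ℕ, ∃ h : e i ∈ A.domain, A ⟨e i, h⟩ = lam i • e i

/-- The spectral projection `P_m`: the orthogonal projection of `H` onto the span of the first `m`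
vectors of the eigenbasis. -/
def spectralProj (e : HilbertBasis ℕ ℝ H) (m : ℕ) : H →L[ℝ] H :=
  haveI : FiniteDimensional ℝ (Submodule.span ℝ (Set.range fun i : Fin m => e i)) :=
    FiniteDimensional.span_of_finite ℝ (Set.finite_range _)
  (Submodule.span ℝ (Set.range fun i : Fin m => e i)).starProjection

/-- `Z` is positively invariant for `S`. -/
def PositivelyInvariant (S : ℝ → H → H) (Z : Set H) : Prop :=
  ∀ t : ℝ, 0 ≤ t → MapsTo (S t) Z Z

/-- The squeezing property of `S = S(tstar)` on the positively invariant set `Z` with respect to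
the orthogonal projection `P` of finite rank: there is a constant `0 < δ < 1` such that every two
points of `Z` are either contracted by `S` with factor `δ`, or have images whose difference is
dominated by its `P`-component. -/
def SqueezingProperty [CompleteSpace H] (S : ℝ → H → H) (tstar : ℝ) (P : H →L[ℝ] H)
    (Z : Set H) : Prop :=
  0 < tstar ∧ PositivelyInvariant S Z ∧
  IsStarProjection P ∧ FiniteDimensional ℝ P.range ∧
  ∃ δ : ℝ, 0 < δ ∧ δ < 1 ∧ ∀ u ∈ Z, ∀ v ∈ Z,
    ‖S tstar u - S tstar v‖ ≤ δ * ‖u - v‖ ∨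
    ‖(1 - P) (S tstar u - S tstar v)‖ ≤ ‖P (S tstar u - S tstar v)‖

end Operator

/-! ### Weak solutions and the solution semiflow -/

/-- The domain of `A` is contained in `E`, and there the norm of `E` is controlled by the energy
norm of `A`: `‖u‖_E² ≤ κ (⟨A u, u⟩ + ‖u‖²)`. -/
def EnergyControlsE {d : ℕ} {Ω : Set (Euc d)} (A : L2 Ω →ₗ.[ℝ] L2 Ω) : Prop :=
  ∃ κ : ℝ, ∀ u : A.domain, MemH1 (u : L2 Ω) ∧
    normE (u : L2 Ω) ^ 2 ≤ κ * (⟪A u, (u : L2 Ω)⟫ + ‖(u : L2 Ω)‖ ^ 2)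

/-- `g` is a weak solution on `[0, ∞)` of `dg/dt + A g = f(g)`, of class
`C([0,∞), H) ∩ L²_loc([0,∞), E)`. The equation
`d/dt (g, ζ) = - (g, A ζ) + (f(g), ζ)`, `ζ ∈ D(A)`, is meant in the sense of (locally) absolutely
continuous functions of time, that is, in its time-integrated form; `f` acts pointwise in `x`. -/
structure IsWeakSolution {d : ℕ} {Ω : Set (Euc d)} (A : L2 Ω →ₗ.[ℝ] L2 Ω) (f : Euc d → Euc d)
    (g : ℝ → L2 Ω) : Prop where
  continuousOn : ContinuousOn g (Ici 0)
  mem_E : ∀ᵐ t ∂(volume.restrict (Ioi (0 : ℝ))), MemH1 (g t)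
  sq_integrable_E : ∀ T : ℝ, 0 < T → IntegrableOn (fun t => normE (g t) ^ 2) (Ioc 0 T)
  pairing_integrable : ∀ ζ : A.domain, ∀ᵐ s ∂(volume.restrict (Ioi (0 : ℝ))),
    IntegrableOn (fun x => ⟪f (g s x), (ζ : L2 Ω) x⟫) Ω
  pairing_locallyIntegrable : ∀ ζ : A.domain, ∀ T : ℝ, 0 < T →
    IntervalIntegrable (fun s => ∫ x in Ω, ⟪f (g s x), (ζ : L2 Ω) x⟫) volume 0 T
  equation : ∀ ζ : A.domain, ∀ t : ℝ, 0 ≤ t →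
    ⟪g t, (ζ : L2 Ω)⟫ - ⟪g 0, (ζ : L2 Ω)⟫ =
      ∫ s in (0 : ℝ)..t, (- ⟪g s, A ζ⟫ + ∫ x in Ω, ⟪f (g s x), (ζ : L2 Ω) x⟫)

/-- `S` is a solution semiflow of `dg/dt + A g = f(g)` on `H`: a one-parameter semigroup of maps
of `H` all of whose trajectories are weak solutions. -/
structure IsSolutionSemiflow {d : ℕ} {Ω : Set (Euc d)} (A : L2 Ω →ₗ.[ℝ] L2 Ω)
    (f : Euc d → Euc d) (S : ℝ → L2 Ω → L2 Ω) : Prop where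
  zero : ∀ g₀ : L2 Ω, S 0 g₀ = g₀
  add : ∀ s t : ℝ, 0 ≤ s → 0 ≤ t → ∀ g₀ : L2 Ω, S (s + t) g₀ = S s (S t g₀)
  isWeakSolution : ∀ g₀ : L2 Ω, IsWeakSolution A f (fun t => S t g₀)

/-- The Lipschitz condition `‖f(g) - f(h)‖_H ≤ C ‖g - h‖_E` on `M`; in particular
`f(g) - f(h) ∈ H`. -/
def LipschitzEH {d : ℕ} {Ω : Set (Euc d)} (f : Euc d → Euc d) (M : Set (L2 Ω)) (C : ℝ) : Prop :=
  ∀ g ∈ M, ∀ h ∈ M,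
    eLpNorm (fun x => f (g x) - f (h x)) 2 (volume.restrict Ω) ≤
      ENNReal.ofReal (C * normE (g - h))

/-- The one-sided condition `⟨f(g) - f(h), g - h⟩_H ≤ Cstar ‖g - h‖²_H` on `M`. -/
def OneSidedMonotone {d : ℕ} {Ω : Set (Euc d)} (f : Euc d → Euc d) (M : Set (L2 Ω))
    (Cstar : ℝ) : Prop :=
  ∀ g ∈ M, ∀ h ∈ M,
    ∫ x in Ω, ⟪f (g x) - f (h x), g x - h x⟫ ≤ Cstar * ‖g - h‖ ^ 2

end

/-!
Let `w = g - h` be the difference of two trajectories in `M` and `F = f(g) - f(h)`, so that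
`dw/dt + A w = F`. Write `a = ⟨A w, w⟩` for the energy (possibly infinite) and `n = ‖w‖²`.
The Lipschitz condition and the embedding of the form domain of `A` into `E` give
`‖F‖² ≤ 2 K (a + n)` with a constant `K`. If `μ' = K (μ + 1)`, then `φ = a - μ n` satisfies

`φ' = -2 ‖(A - μ) w‖² + 2 ⟨F, (A - μ) w⟩ - 2 μ φ - μ' n ≤ ‖F‖² / 2 - 2 μ φ - μ' n ≤ (K - 2 μ) φ`,

so that the cone `a ≤ μ n` is invariant forward in time (`IsModalSolution.eventually_cone`).
Take `μ(1) = λ / 2`, where `λ` is the least eigenvalue beyond those of `P`. There are two cases.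
* If `w` meets the cone at some time in `[0, 1]`, then `a ≤ (λ / 2) n` at time `1`, which forces
  `‖(1 - P) w(1)‖ ≤ ‖P w(1)‖`.
* Otherwise `a > μ n` on all of `[0, 1]`, with `μ` as large as desired when `λ` is large, and the
  energy balance `n' = -2 a + 2 ⟨F, w⟩ ≤ 2 (C* - μ) n` yields the contraction
  (`IsModalSolution.norm_sq_le_of_energy`).

No regularity of `w` beyond that of weak solutions is used: both differential inequalities hold
coordinate by coordinate in the eigenbasis, and the sum over the coordinates is controlled by a
one-sided dominated convergence theorem (`eventually_integral_sum_le`), in which an infinite energy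
only helps. The bound `‖F‖² ≤ 2 K (a + n)` needs the estimate of the norm of `E`, assumed on the
domain of `A`, at every vector of finite energy; this follows from the closedness of weak
derivatives (`normE_sq_le_of_summable`). Finally, the eigenvalues tend to infinity because the
resolvent is compact.
-/

noncomputable section

/-! ### Spectral projections and eigenvalues -/

section Spectral

variable {H : Type*} [NormedAddCommGroup H] [InnerProductSpace ℝ H]

/-- Were the eigenvalues bounded, the resolvent would be bounded below along the eigenbasis, whose
image could then have no convergent subsequence. -/
lemma IsOrderedEigenbasis.tendsto_eigenvalue_atTop {A : H →ₗ.[ℝ] H} {e : HilbertBasis ℕ ℝ H}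
    {lam : ℕ → ℝ} (he : IsOrderedEigenbasis A e lam) (hR : HasCompactResolvent A) :
    Tendsto lam atTop atTop := by
  rcases tendsto_atTop_of_monotone he.mono with h | ⟨l, hl⟩
  · exact h
  exfalso
  obtain ⟨μ, R, hRc, -, hRA⟩ := hR
  have hRe (i : ℕ) : (lam i - μ) • R (e i) = e i := by
    obtain ⟨h, h'⟩ := he.eigen i
    have := hRA ⟨e i, h⟩
    rwa [h', ← sub_smul, map_smul] at this
  obtain ⟨K, hK, hKs⟩ := hRc.image_closedBall_subset_compact (f := (R : H →ₗ[ℝ] H)) 1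
  have hmem (i : ℕ) : R (e i) ∈ K :=
    hKs ⟨e i, by simp [e.orthonormal.norm_eq_one i], rfl⟩
  obtain ⟨a, -, φ, hφ, ha⟩ := hK.tendsto_subseq hmem
  have h1 : Tendsto (fun n => e (φ n)) atTop (𝓝 ((l - μ) • a)) := by
    have := ((hl.comp hφ.tendsto_atTop).sub_const μ).smul ha
    refine this.congr fun n => ?_
    simpa using hRe (φ n)
  have h2 := (h1.sub (h1.comp (tendsto_add_atTop_nat 1))).norm.pow 2
  have h3 : ∀ n, ‖e (φ n) - e (φ (n + 1))‖ ^ 2 = 2 := by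
    intro n
    have h0 : ⟪e (φ n), e (φ (n + 1))⟫ = 0 :=
      e.orthonormal.inner_eq_zero (hφ (Nat.lt_succ_self n)).ne
    rw [norm_sub_sq_real, h0, e.orthonormal.norm_eq_one, e.orthonormal.norm_eq_one]
    norm_num
  have h4 := h2.congr (f₂ := fun _ => (2 : ℝ)) (by intro n; exact h3 n)
  have := tendsto_nhds_unique h4 tendsto_const_nhds
  simp at this

lemma HilbertBasis.hasSum_inner_sq {ι : Type*} (e : HilbertBasis ι ℝ H) (x : H) :
    HasSum (fun i => ⟪e i, x⟫ ^ 2) (‖x‖ ^ 2) := by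
  have h : (fun i => ⟪e i, x⟫ ^ 2) = fun i => ⟪x, e i⟫ * ⟪e i, x⟫ := by
    ext i
    rw [sq, real_inner_comm]
  rw [h, ← real_inner_self_eq_norm_sq]
  exact e.hasSum_inner_mul_inner x x

lemma spectralProj_apply (e : HilbertBasis ℕ ℝ H) (m : ℕ) (x : H) :
    spectralProj e m x = ∑ i ∈ Finset.range m, ⟪e i, x⟫ • e i := by
  have : FiniteDimensional ℝ (Submodule.span ℝ (Set.range fun i : Fin m => e i)) :=
    FiniteDimensional.span_of_finite ℝ (Set.finite_range _)
  refine Submodule.eq_starProjection_of_mem_of_inner_eq_zero ?_ ?_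
  · refine Submodule.sum_mem _ fun i hi => Submodule.smul_mem _ _ (Submodule.subset_span ?_)
    exact ⟨⟨i, Finset.mem_range.1 hi⟩, rfl⟩
  · intro y hy
    induction hy using Submodule.span_induction with
    | mem y hy =>
      obtain ⟨j, rfl⟩ := hy
      have := e.orthonormal.inner_left_sum (fun i => ⟪e i, x⟫)
        (Finset.mem_range.2 j.2)
      rw [inner_sub_left, this]
      simp [real_inner_comm]
    | zero => simp
    | add y z _ _ hy hz => rw [inner_add_right, hy, hz, add_zero]
    | smul c y _ hy => rw [inner_smul_right, hy, mul_zero]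

lemma norm_spectralProj_sq (e : HilbertBasis ℕ ℝ H) (m : ℕ) (x : H) :
    ‖spectralProj e m x‖ ^ 2 = ∑ i ∈ Finset.range m, ⟪e i, x⟫ ^ 2 := by
  rw [spectralProj_apply, ← real_inner_self_eq_norm_sq, e.orthonormal.inner_sum]
  simp [sq]

lemma norm_one_sub_spectralProj_sq (e : HilbertBasis ℕ ℝ H) (m : ℕ) (x : H) :
    ‖(1 - spectralProj e m) x‖ ^ 2 = ‖x‖ ^ 2 - ∑ i ∈ Finset.range m, ⟪e i, x⟫ ^ 2 := by
  have h : ⟪x, spectralProj e m x⟫ = ∑ i ∈ Finset.range m, ⟪e i, x⟫ ^ 2 := by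
    rw [spectralProj_apply, inner_sum]
    refine Finset.sum_congr rfl fun i _ => ?_
    rw [inner_smul_right, real_inner_comm, sq]
  change ‖x - spectralProj e m x‖ ^ 2 = _
  rw [norm_sub_sq_real, h, norm_spectralProj_sq]
  ring

lemma isStarProjection_spectralProj [CompleteSpace H] (e : HilbertBasis ℕ ℝ H) (m : ℕ) :
    IsStarProjection (spectralProj e m) :=
  have : FiniteDimensional ℝ (Submodule.span ℝ (Set.range fun i : Fin m => e i)) :=
    FiniteDimensional.span_of_finite ℝ (Set.finite_range _)
  isStarProjection_starProjection

lemma finiteDimensional_range_spectralProj (e : HilbertBasis ℕ ℝ H) (m : ℕ) :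
    FiniteDimensional ℝ (spectralProj e m).range := by
  have : FiniteDimensional ℝ (Submodule.span ℝ (Set.range fun i : Fin m => e i)) :=
    FiniteDimensional.span_of_finite ℝ (Set.finite_range _)
  rw [spectralProj, Submodule.range_starProjection]
  infer_instance

end Spectral

/-! ### Weak derivatives and the energy bound for the norm of `E` -/

section WeakDerivative

variable {d : ℕ} {Ω : Set (Euc d)}

/-- Integration against a fixed square integrable scalar function, as a bounded operator on
`L²(Ω, ℝ^d)`. -/
def integralSMulCLM (φ : Euc d → ℝ) (hφ : MemLp φ 2 (volume.restrict Ω)) : L2 Ω →L[ℝ] Euc d :=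
  ContinuousLinearMap.lpPairing (volume.restrict Ω) 2 2 (ContinuousLinearMap.lsmul ℝ ℝ)
    (hφ.toLp φ)

lemma integralSMulCLM_apply (φ : Euc d → ℝ) (hφ : MemLp φ 2 (volume.restrict Ω)) (u : L2 Ω) :
    integralSMulCLM φ hφ u = ∫ x in Ω, φ x • u x := by
  rw [integralSMulCLM, ContinuousLinearMap.lpPairing_eq_integral]
  refine integral_congr_ae ?_
  filter_upwards [hφ.coeFn_toLp] with x hx
  simp [hx]

lemma memLp_test {φ : Euc d → ℝ} (hφ : ContDiff ℝ ∞ φ) (hc : HasCompactSupport φ) :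
    MemLp φ 2 (volume.restrict Ω) :=
  hφ.continuous.memLp_of_hasCompactSupport hc

lemma memLp_fderiv_test {φ : Euc d → ℝ} (hφ : ContDiff ℝ ∞ φ) (hc : HasCompactSupport φ)
    (y : Euc d) : MemLp (fun x => fderiv ℝ φ x y) 2 (volume.restrict Ω) := by
  refine Continuous.memLp_of_hasCompactSupport ?_ (hc.fderiv_apply ℝ y)
  exact (hφ.continuous_fderiv (by simp)).clm_apply continuous_const

/-- The defining identity of the weak derivative as an identity between bounded operators; it makes
the linearity and the closedness of the weak derivative evident. -/
lemma hasWeakPartial_iff {i : Fin d} {u v : L2 Ω} :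
    HasWeakPartial i u v ↔ ∀ (φ : Euc d → ℝ) (hφ : ContDiff ℝ ∞ φ) (hc : HasCompactSupport φ),
      tsupport φ ⊆ Ω → integralSMulCLM _ (memLp_fderiv_test hφ hc (EuclideanSpace.single i 1)) u =
        - integralSMulCLM φ (memLp_test hφ hc) v := by
  simp only [HasWeakPartial, integralSMulCLM_apply]

lemma HasWeakPartial.sub {i : Fin d} {u u' v v' : L2 Ω} (h : HasWeakPartial i u v)
    (h' : HasWeakPartial i u' v') : HasWeakPartial i (u - u') (v - v') := by
  rw [hasWeakPartial_iff] at *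
  intro φ hφ hc hs
  rw [map_sub, map_sub, h φ hφ hc hs, h' φ hφ hc hs]
  abel

lemma HasWeakPartial.sum_smul {i : Fin d} {ι : Type*} (s : Finset ι) (c : ι → ℝ) {u v : ι → L2 Ω}
    (h : ∀ k, HasWeakPartial i (u k) (v k)) :
    HasWeakPartial i (∑ k ∈ s, c k • u k) (∑ k ∈ s, c k • v k) := by
  simp only [hasWeakPartial_iff] at *
  intro φ hφ hc hs
  simp only [map_sum, map_smul, h _ φ hφ hc hs, smul_neg, Finset.sum_neg_distrib]

lemma HasWeakPartial.of_tendsto {i : Fin d} {ι : Type*} {l : Filter ι} [l.NeBot]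
    {u v : ι → L2 Ω} {u₀ v₀ : L2 Ω} (h : ∀ k, HasWeakPartial i (u k) (v k))
    (hu : Tendsto u l (𝓝 u₀)) (hv : Tendsto v l (𝓝 v₀)) : HasWeakPartial i u₀ v₀ := by
  simp only [hasWeakPartial_iff] at *
  intro φ hφ hc hs
  have h1 := ((integralSMulCLM _
    (memLp_fderiv_test hφ hc (EuclideanSpace.single i 1))).continuous.tendsto u₀).comp hu
  have h2 := (((integralSMulCLM φ (memLp_test hφ hc)).continuous.tendsto v₀).comp hv).neg
  refine tendsto_nhds_unique h1 (h2.congr fun k => ?_)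
  simp [h k φ hφ hc hs]

lemma HasWeakPartial.unique (hΩ : IsOpen Ω) {i : Fin d} {u v v' : L2 Ω}
    (h : HasWeakPartial i u v) (h' : HasWeakPartial i u v') : v = v' := by
  have h0 := h.sub h'
  rw [sub_self, hasWeakPartial_iff] at h0
  rw [← sub_eq_zero, Lp.ext_iff]
  have hloc : LocallyIntegrable (v - v' : L2 Ω) (volume.restrict Ω) :=
    (Lp.memLp (v - v')).locallyIntegrable one_le_two
  have key := hΩ.ae_eq_zero_of_integral_contDiff_smul_eq_zero
    (μ := volume.restrict Ω) (hloc.locallyIntegrableOn Ω) (fun φ hφ hc hs => by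
      have := h0 φ hφ hc hs
      rw [map_zero, eq_comm, neg_eq_zero, integralSMulCLM_apply] at this
      exact this)
  filter_upwards [key, ae_restrict_mem hΩ.measurableSet,
    Lp.coeFn_zero (Euc d) 2 (volume.restrict Ω)] with x hx hxΩ h0x
  rw [hx hxΩ, h0x, Pi.zero_apply]

lemma MemH1.hasWeakPartial {u : L2 Ω} (hu : MemH1 u) (i : Fin d) :
    HasWeakPartial i u (weakPartial i u) := by
  rw [weakPartial, dif_pos (hu i)]
  exact (hu i).choose_spec

lemma HasWeakPartial.weakPartial_eq (hΩ : IsOpen Ω) {i : Fin d} {u v : L2 Ω}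
    (h : HasWeakPartial i u v) : weakPartial i u = v := by
  have h' : ∃ v, HasWeakPartial i u v := ⟨v, h⟩
  rw [weakPartial, dif_pos h']
  exact h'.choose_spec.unique hΩ h

lemma normE_sq (u : L2 Ω) : normE u ^ 2 = (∑ i : Fin d, ‖weakPartial i u‖ ^ 2) + ‖u‖ ^ 2 :=
  Real.sq_sqrt (by positivity)

lemma normE_nonneg (u : L2 Ω) : 0 ≤ normE u := Real.sqrt_nonneg _

lemma norm_weakPartial_le_normE (i : Fin d) (u : L2 Ω) : ‖weakPartial i u‖ ≤ normE u := by
  refine Real.le_sqrt_of_sq_le ?_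
  have := Finset.single_le_sum (f := fun i => ‖weakPartial i u‖ ^ 2)
    (fun _ _ => by positivity) (Finset.mem_univ i)
  nlinarith [sq_nonneg ‖u‖]

lemma norm_le_normE (u : L2 Ω) : ‖u‖ ≤ normE u :=
  Real.le_sqrt_of_sq_le (le_add_of_nonneg_left (by positivity))

/-- The differences of elements of a bounded subset of `E` are bounded in `E`. -/
lemma normE_sub_sq_le (hΩ : IsOpen Ω) {u v : L2 Ω} (hu : MemH1 u) (hv : MemH1 v) {R : ℝ}
    (huR : normE u ≤ R) (hvR : normE v ≤ R) : normE (u - v) ^ 2 ≤ (d + 1) * (2 * R) ^ 2 := by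
  have hp (i : Fin d) : ‖weakPartial i (u - v)‖ ^ 2 ≤ (2 * R) ^ 2 := by
    rw [((hu.hasWeakPartial i).sub (hv.hasWeakPartial i)).weakPartial_eq hΩ]
    gcongr
    linarith [norm_sub_le (weakPartial i u) (weakPartial i v), norm_weakPartial_le_normE i u,
      norm_weakPartial_le_normE i v]
  have h0 : ‖u - v‖ ^ 2 ≤ (2 * R) ^ 2 := by
    gcongr
    linarith [norm_sub_le u v, norm_le_normE u, norm_le_normE v]
  rw [normE_sq]
  calc _ ≤ (∑ _i : Fin d, (2 * R) ^ 2) + (2 * R) ^ 2 := by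
        gcongr ?_ + ?_
        exact Finset.sum_le_sum fun i _ => hp i
    _ = _ := by simp; ring

section Form

variable {A : L2 Ω →ₗ.[ℝ] L2 Ω} {e : HilbertBasis ℕ ℝ (L2 Ω)} {lam : ℕ → ℝ}

/-- Finite linear combinations of eigenvectors lie in the domain, and the quadratic form of the
operator is diagonal on them. -/
lemma IsOrderedEigenbasis.quadForm_sum (he : IsOrderedEigenbasis A e lam) (c : ℕ → ℝ)
    (s : Finset ℕ) : ∃ h : ∑ i ∈ s, c i • e i ∈ A.domain,
      ⟪A ⟨∑ i ∈ s, c i • e i, h⟩, ∑ i ∈ s, c i • e i⟫ = ∑ i ∈ s, lam i * c i ^ 2 := by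
  choose hd hA using he.eigen
  refine ⟨A.domain.sum_mem fun i _ => A.domain.smul_mem _ (hd i), ?_⟩
  have h1 : A ⟨∑ i ∈ s, c i • e i, A.domain.sum_mem fun i _ => A.domain.smul_mem _ (hd i)⟩ =
      ∑ i ∈ s, (c i * lam i) • e i := by
    have : (⟨∑ i ∈ s, c i • e i, A.domain.sum_mem fun i _ => A.domain.smul_mem _ (hd i)⟩ :
        A.domain) = ∑ i ∈ s, c i • (⟨e i, hd i⟩ : A.domain) := by
      ext1; simp
    rw [this]
    change A.toFun _ = _
    rw [map_sum]
    refine Finset.sum_congr rfl fun i _ => ?_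
    rw [map_smul, mul_smul]
    exact congrArg _ (hA i)
  rw [h1, e.orthonormal.inner_sum]
  refine Finset.sum_congr rfl fun i _ => ?_
  simp
  ring

lemma IsOrderedEigenbasis.eigenvalue_nonneg (he : IsOrderedEigenbasis A e lam)
    (hA : ∀ x : A.domain, 0 ≤ ⟪A x, (x : L2 Ω)⟫) (i : ℕ) : 0 ≤ lam i := by
  obtain ⟨h, h'⟩ := he.quadForm_sum (fun _ => 1) {i}
  have := hA ⟨_, h⟩
  rw [h'] at this
  simpa using this

/-- A vector of finite `A`-energy belongs to `E`, and its norm there is controlled by the energy: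
the bound on the domain of `A` extends to the whole form domain. -/
lemma normE_sq_le_of_summable (hΩ : IsOpen Ω) (he : IsOrderedEigenbasis A e lam)
    (hlam : ∀ i, 0 ≤ lam i) {κ : ℝ} (hκ : 0 ≤ κ)
    (hE : ∀ u : A.domain, MemH1 (u : L2 Ω) ∧
      normE (u : L2 Ω) ^ 2 ≤ κ * (⟪A u, (u : L2 Ω)⟫ + ‖(u : L2 Ω)‖ ^ 2))
    (w : L2 Ω) (hw : Summable fun i => lam i * ⟪e i, w⟫ ^ 2) :
    normE w ^ 2 ≤ κ * ((∑' i, lam i * ⟪e i, w⟫ ^ 2) + ‖w‖ ^ 2) := by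
  set c : ℕ → ℝ := fun i => ⟪e i, w⟫ with hc
  choose hd hA using he.eigen
  have heE (i : ℕ) : MemH1 (e i) := (hE ⟨e i, hd i⟩).1
  have hnorm (s : Finset ℕ) : ‖∑ i ∈ s, c i • e i‖ ^ 2 = ∑ i ∈ s, c i ^ 2 := by
    rw [← real_inner_self_eq_norm_sq, e.orthonormal.inner_sum]
    simp [sq]
  have hbd (s : Finset ℕ) : normE (∑ i ∈ s, c i • e i) ^ 2 ≤
      κ * (∑ i ∈ s, lam i * c i ^ 2 + ∑ i ∈ s, c i ^ 2) := by
    obtain ⟨h, h'⟩ := he.quadForm_sum c s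
    have := (hE ⟨_, h⟩).2
    rwa [h', hnorm] at this
  have hc2 : HasSum (fun i => c i ^ 2) (‖w‖ ^ 2) := e.hasSum_inner_sq w
  have hwp (j : Fin d) (s : Finset ℕ) : HasWeakPartial j (∑ i ∈ s, c i • e i)
      (∑ i ∈ s, c i • weakPartial j (e i)) :=
    HasWeakPartial.sum_smul s c fun k => (heE k).hasWeakPartial j
  -- The energy bound on finite blocks of the expansion makes the differentiated series Cauchy.
  have hsum (j : Fin d) : Summable fun i => c i • weakPartial j (e i) := by
    have hq : Summable fun i => κ * (lam i * c i ^ 2 + c i ^ 2) :=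
      (hw.add hc2.summable).mul_left κ
    rw [summable_iff_vanishing_norm] at hq ⊢
    intro ε hε
    obtain ⟨s, hs⟩ := hq (ε ^ 2) (by positivity)
    refine ⟨s, fun t ht => ?_⟩
    refine lt_of_pow_lt_pow_left₀ 2 hε.le (lt_of_le_of_lt ?_ (hs t ht))
    rw [← (hwp j t).weakPartial_eq hΩ]
    refine (pow_le_pow_left₀ (norm_nonneg _) (norm_weakPartial_le_normE j _) 2).trans
      ((hbd t).trans ?_)
    rw [← Finset.sum_add_distrib, Finset.mul_sum]
    exact le_abs_self _
  have hexp : HasSum (fun i => c i • e i) w := by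
    simpa only [e.repr_apply_apply] using e.hasSum_repr w
  have hlim (j : Fin d) : HasWeakPartial j w (∑' i, c i • weakPartial j (e i)) :=
    HasWeakPartial.of_tendsto (hwp j) hexp (hsum j).hasSum
  have hle (s : Finset ℕ) : (∑ j : Fin d, ‖∑ i ∈ s, c i • weakPartial j (e i)‖ ^ 2) +
      ∑ i ∈ s, c i ^ 2 ≤ κ * ((∑' i, lam i * c i ^ 2) + ‖w‖ ^ 2) := by
    have := hbd s
    rw [normE_sq, hnorm] at this
    simp only [(hwp _ s).weakPartial_eq hΩ] at this
    refine this.trans ?_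
    gcongr
    · exact hw.sum_le_tsum s fun i _ => mul_nonneg (hlam i) (sq_nonneg _)
    · rw [← hc2.tsum_eq]
      exact hc2.summable.sum_le_tsum s fun i _ => sq_nonneg _
  rw [normE_sq]
  refine le_of_tendsto' (Tendsto.add (tendsto_finsetSum _ fun j _ => ?_) hc2) hle
  rw [(hlim j).weakPartial_eq hΩ]
  exact ((hsum j).hasSum.norm).pow 2

end Form

end WeakDerivative

/-! ### Calculus of primitives and passage to the limit in partial sums -/

/-- The chain rule for `p x²`, where `x` is a primitive of an integrable function `b` and `p` is
continuously differentiable. -/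
lemma integral_deriv_mul_sq {x b p p' : ℝ → ℝ} {s t : ℝ} (hst : s ≤ t)
    (hb : IntervalIntegrable b volume s t)
    (hx : ∀ τ ∈ Icc s t, x τ = x s + ∫ r in s..τ, b r)
    (hp : ∀ τ, HasDerivAt p (p' τ) τ) (hp' : Continuous p') :
    IntervalIntegrable (fun τ => p' τ * x τ ^ 2 + 2 * p τ * x τ * b τ) volume s t ∧
      ∫ τ in s..t, (p' τ * x τ ^ 2 + 2 * p τ * x τ * b τ) = p t * x t ^ 2 - p s * x s ^ 2 := by
  set y : ℝ → ℝ := fun τ => x s + ∫ r in s..τ, b r with hy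
  have hyx : ∀ τ ∈ Icc s t, x τ = y τ := hx
  have hyac : AbsolutelyContinuousOnInterval y s t := by
    have hc : AbsolutelyContinuousOnInterval (fun _ : ℝ => x s) s t :=
      contDiffOn_const.absolutelyContinuousOnInterval (f := fun _ : ℝ => x s)
    exact hc.add (hb.absolutelyContinuousOnInterval_intervalIntegral left_mem_uIcc)
  have hpac : AbsolutelyContinuousOnInterval p s t := by
    have h1 : ContDiff ℝ 1 p := contDiff_one_iff_deriv.2
      ⟨fun τ => (hp τ).differentiableAt, by
        rwa [show deriv p = p' from funext fun τ => (hp τ).deriv]⟩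
    exact h1.contDiffOn.absolutelyContinuousOnInterval
  have hz := hpac.mul (hyac.mul hyac)
  have hder : deriv (p * (y * y)) =ᵐ[volume.restrict (uIoc s t)]
      fun τ => p' τ * x τ ^ 2 + 2 * p τ * x τ * b τ := by
    rw [EventuallyEq, ae_restrict_iff' measurableSet_uIoc]
    filter_upwards [hb.ae_hasDerivAt_integral] with τ hτ hmem
    have hmem' : τ ∈ Icc s t := by
      rw [uIoc_of_le hst] at hmem
      exact Ioc_subset_Icc_self hmem
    have hyd : HasDerivAt y (b τ) τ :=
      (hτ (uIoc_subset_uIcc hmem) s left_mem_uIcc).const_add (x s)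
    rw [((hp τ).mul (hyd.mul hyd)).deriv, hyx τ hmem', Pi.mul_apply]
    ring
  refine ⟨hz.intervalIntegrable_deriv.congr_ae hder, ?_⟩
  rw [← intervalIntegral.integral_congr_ae_restrict hder, hz.integral_deriv_eq_sub,
    hyx t (right_mem_Icc.2 hst), hyx s (left_mem_Icc.2 hst)]
  simp only [Pi.mul_apply]
  ring

/-- A divergent series of nonnegative terms is allowed for `β`: its partial sums then dominate
those of `α`. -/
lemma eventually_sum_sub_le {α β : ℕ → ℝ} (hα : Summable α) (hβ : ∀ i, 0 ≤ β i)
    (h : Summable β → ∑' i, α i ≤ ∑' i, β i) {ε : ℝ} (hε : 0 < ε) :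
    ∀ᶠ N in atTop, ∑ i ∈ Finset.range N, (α i - β i) ≤ ε := by
  simp only [Finset.sum_sub_distrib]
  by_cases hs : Summable β
  · have := hα.hasSum.tendsto_sum_nat.sub hs.hasSum.tendsto_sum_nat
    exact this.eventually_le_const (by linarith [h hs])
  · have h1 := (not_summable_iff_tendsto_nat_atTop_of_nonneg hβ).1 hs
    have := hα.hasSum.tendsto_sum_nat.add_atBot (tendsto_neg_atTop_atBot.comp h1)
    exact this.eventually_le_atBot ε

/-- A one-sided dominated convergence theorem: partial sums bounded above, and with nonpositive
upper limit at every point, have integrals with nonpositive upper limit. -/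
lemma eventually_integral_sum_le {D : ℕ → ℝ → ℝ} {s t G : ℝ} (hst : s ≤ t)
    (hD : ∀ i, IntervalIntegrable (D i) volume s t)
    (hG : ∀ τ ∈ Ioc s t, ∀ N, ∑ i ∈ Finset.range N, D i τ ≤ G)
    (hlim : ∀ τ ∈ Ioc s t, ∀ ε > 0, ∀ᶠ N in atTop, ∑ i ∈ Finset.range N, D i τ ≤ ε)
    {ε : ℝ} (hε : 0 < ε) :
    ∀ᶠ N in atTop, ∑ i ∈ Finset.range N, ∫ τ in s..t, D i τ ≤ ε := by
  have hsum (N : ℕ) : IntervalIntegrable (fun τ => ∑ i ∈ Finset.range N, D i τ) volume s t := by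
    have := IntervalIntegrable.sum (Finset.range N) (f := D) (μ := volume) (a := s) (b := t)
      fun i _ => hD i
    simpa [Finset.sum_fn] using this
  have hpos (N : ℕ) :
      IntervalIntegrable (fun τ => max (∑ i ∈ Finset.range N, D i τ) 0) volume s t := by
    have := hsum N
    rw [intervalIntegrable_iff] at this ⊢
    exact this.pos_part
  have key : Tendsto (fun N => ∫ τ in s..t, max (∑ i ∈ Finset.range N, D i τ) 0) atTop
      (𝓝 (∫ _τ in s..t, (0 : ℝ))) := by
    refine intervalIntegral.tendsto_integral_filter_of_dominated_convergence (fun _ => max G 0)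
      (Eventually.of_forall fun N => ?_) (Eventually.of_forall fun N => ?_) (by simp) ?_
    · exact (intervalIntegrable_iff.1 (hpos N)).aestronglyMeasurable
    · refine Eventually.of_forall fun τ hτ => ?_
      rw [uIoc_of_le hst] at hτ
      rw [Real.norm_of_nonneg (le_max_right _ _)]
      exact max_le_max_right _ (hG τ hτ N)
    · refine Eventually.of_forall fun τ hτ => ?_
      rw [uIoc_of_le hst] at hτ
      refine Metric.tendsto_nhds.2 fun η hη => ?_
      filter_upwards [hlim τ hτ (η / 2) (by positivity)] with N hN
      rw [dist_zero_right, Real.norm_of_nonneg (le_max_right _ _)]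
      exact max_lt (by linarith) hη
  rw [intervalIntegral.integral_zero] at key
  filter_upwards [key.eventually_le_const hε] with N hN
  rw [← intervalIntegral.integral_finsetSum fun i _ => hD i]
  exact (intervalIntegral.integral_mono_on hst (hsum N) (hpos N)
    fun τ _ => le_max_left _ _).trans hN

/-! ### Evolution in the eigenbasis -/

section Modal

variable {H : Type*} [NormedAddCommGroup H] [InnerProductSpace ℝ H]

/-- The curve `w` solves `dw/dt + A w = F` on `[0, 1]` coordinatewise in the eigenbasis `e` of `A`,
with a bounded right-hand side `F`. -/
structure IsModalSolution (e : HilbertBasis ℕ ℝ H) (lam : ℕ → ℝ) (w F : ℝ → H) : Prop where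
  continuousOn : ContinuousOn w (Icc 0 1)
  integrable : ∀ i, IntervalIntegrable (fun τ => ⟪e i, F τ⟫) volume 0 1
  equation : ∀ i, ∀ t ∈ Icc (0 : ℝ) 1, ⟪e i, w t⟫ - ⟪e i, w 0⟫ =
    ∫ τ in (0 : ℝ)..t, (-(lam i * ⟪e i, w τ⟫) + ⟪e i, F τ⟫)
  bounded : ∃ B, ∀ t ∈ Icc (0 : ℝ) 1, ‖F t‖ ≤ B

variable {e : HilbertBasis ℕ ℝ H} {lam : ℕ → ℝ} {w F : ℝ → H}

/-- A termwise differential inequality for a weighted sum of squares of coordinates, with weights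
`p i`, implies that the sum does not increase, up to an error vanishing as the truncation is
removed. The bound `β` of the dissipative terms need not be summable. -/
lemma IsModalSolution.eventually_weighted_sum_le (hw : IsModalSolution e lam w F) {s t : ℝ}
    (hs : 0 ≤ s) (hst : s ≤ t) (ht : t ≤ 1) {p p' α β : ℕ → ℝ → ℝ}
    (hp : ∀ i τ, HasDerivAt (p i) (p' i τ) τ) (hp' : ∀ i, Continuous (p' i))
    (hD : ∀ i, ∀ τ ∈ Ioc s t, p' i τ * ⟪e i, w τ⟫ ^ 2 + 2 * p i τ * ⟪e i, w τ⟫ *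
      (-(lam i * ⟪e i, w τ⟫) + ⟪e i, F τ⟫) ≤ α i τ - β i τ)
    (hα : ∀ τ ∈ Ioc s t, Summable fun i => α i τ) (hβ : ∀ i, ∀ τ ∈ Ioc s t, 0 ≤ β i τ)
    {G : ℝ} (hG : ∀ τ ∈ Ioc s t, ∀ N, ∑ i ∈ Finset.range N, α i τ ≤ G)
    (hαβ : ∀ τ ∈ Ioc s t, (Summable fun i => β i τ) → ∑' i, α i τ ≤ ∑' i, β i τ)
    {ε : ℝ} (hε : 0 < ε) :
    ∀ᶠ N in atTop, ∑ i ∈ Finset.range N, p i t * ⟪e i, w t⟫ ^ 2 ≤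
      (∑ i ∈ Finset.range N, p i s * ⟪e i, w s⟫ ^ 2) + ε := by
  have hsub : Icc s t ⊆ Icc 0 1 := Icc_subset_Icc hs ht
  have hb (i : ℕ) : IntervalIntegrable
      (fun τ => -(lam i * ⟪e i, w τ⟫) + ⟪e i, F τ⟫) volume 0 1 := by
    refine IntervalIntegrable.add ?_ (hw.integrable i)
    refine ContinuousOn.intervalIntegrable ?_
    rw [uIcc_of_le zero_le_one]
    exact (continuousOn_const.mul (continuousOn_const.inner hw.continuousOn)).neg
  have hbs (i : ℕ) {a b : ℝ} (ha : a ∈ Icc (0 : ℝ) 1) (hb1 : b ∈ Icc (0 : ℝ) 1) :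
      IntervalIntegrable (fun τ => -(lam i * ⟪e i, w τ⟫) + ⟪e i, F τ⟫) volume a b :=
    (hb i).mono_set (by
      rw [uIcc_of_le zero_le_one]
      exact uIcc_subset_Icc ha hb1)
  have h0 : (0 : ℝ) ∈ Icc (0 : ℝ) 1 := ⟨le_rfl, zero_le_one⟩
  have hs' : s ∈ Icc (0 : ℝ) 1 := hsub (left_mem_Icc.2 hst)
  have ht' : t ∈ Icc (0 : ℝ) 1 := hsub (right_mem_Icc.2 hst)
  have hint (i : ℕ) := integral_deriv_mul_sq (x := fun τ => ⟪e i, w τ⟫) hst (hbs i hs' ht')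
    (fun τ hτ => by
      have h1 := hw.equation i τ (hsub hτ)
      have h2 := hw.equation i s hs'
      have h3 := intervalIntegral.integral_add_adjacent_intervals
        (hbs i h0 hs') (hbs i hs' (hsub hτ))
      linarith) (hp i) (hp' i)
  have hle (τ : ℝ) (hτ : τ ∈ Ioc s t) (N : ℕ) := Finset.sum_le_sum
    fun i (_ : i ∈ Finset.range N) => hD i τ hτ
  have key := eventually_integral_sum_le (G := G) hst (fun i => (hint i).1)
    (fun τ hτ N => (hle τ hτ N).trans ((Finset.sum_le_sum fun i _ =>
      sub_le_self _ (hβ i τ hτ)).trans (hG τ hτ N)))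
    (fun τ hτ η hη => (eventually_sum_sub_le (hα τ hτ) (fun i => hβ i τ hτ)
      (hαβ τ hτ) hη).mono fun N hN => (hle τ hτ N).trans hN) hε
  filter_upwards [key] with N hN
  simp only [(hint _).2, Finset.sum_sub_distrib] at hN
  linarith

lemma HilbertBasis.sum_inner_sq_le (e : HilbertBasis ℕ ℝ H) (x : H) (s : Finset ℕ) :
    ∑ i ∈ s, ⟪e i, x⟫ ^ 2 ≤ ‖x‖ ^ 2 := by
  rw [← (e.hasSum_inner_sq x).tsum_eq]
  exact (e.hasSum_inner_sq x).summable.sum_le_tsum s fun i _ => sq_nonneg _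

/-- The energy cone `⟨A w, w⟩ ≤ μ(τ) ‖w‖²` is invariant forward in time, when its slope solves
`μ' = K (μ + 1)`, `μ(1) = ν`, and `‖F‖² ≤ 2 K (⟨A w, w⟩ + ‖w‖²)`. Indeed `φ = ⟨A w, w⟩ - μ ‖w‖²`
satisfies `φ' ≤ (K - 2 μ) φ`. -/
lemma IsModalSolution.eventually_cone (hw : IsModalSolution e lam w F) (hlam : ∀ i, 0 ≤ lam i)
    {K ν : ℝ} (hK : 0 < K)
    (hF : ∀ τ ∈ Icc (0 : ℝ) 1, (Summable fun i => lam i * ⟪e i, w τ⟫ ^ 2) →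
      ‖F τ‖ ^ 2 ≤ 2 * K * ((∑' i, lam i * ⟪e i, w τ⟫ ^ 2) + ‖w τ‖ ^ 2))
    {s : ℝ} (hs : s ∈ Icc (0 : ℝ) 1) (hsum : Summable fun i => lam i * ⟪e i, w s⟫ ^ 2)
    (hcone : ∑' i, lam i * ⟪e i, w s⟫ ^ 2 ≤
      ((ν + 1) * Real.exp (K * (s - 1)) - 1) * ‖w s‖ ^ 2) {ε : ℝ} (hε : 0 < ε) :
    ∀ᶠ N in atTop, ∑ i ∈ Finset.range N, (lam i - ν) * ⟪e i, w 1⟫ ^ 2 ≤ ε := by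
  obtain ⟨B, hB⟩ := hw.bounded
  -- The weight `E` is an integrating factor: `E' = (2 μ - K) E`.
  set μ : ℝ → ℝ := fun τ => (ν + 1) * Real.exp (K * (τ - 1)) - 1 with hμ
  set E : ℝ → ℝ := fun τ =>
    Real.exp (2 * (ν + 1) / K * Real.exp (K * (τ - 1)) - (2 + K) * τ) with hE
  have hEpos (τ : ℝ) : 0 < E τ := Real.exp_pos _
  have hexp (τ : ℝ) : HasDerivAt (fun τ => Real.exp (K * (τ - 1)))
      (Real.exp (K * (τ - 1)) * K) τ := by
    simpa using (((hasDerivAt_id τ).sub_const 1).const_mul K).exp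
  have hμd (τ : ℝ) : HasDerivAt μ (K * (μ τ + 1)) τ := by
    refine (((hexp τ).const_mul (ν + 1)).sub_const 1).congr_deriv ?_
    simp only [hμ]
    ring
  have hEd (τ : ℝ) : HasDerivAt E (E τ * (2 * μ τ - K)) τ := by
    refine (((hexp τ).const_mul (2 * (ν + 1) / K)).fun_sub
      ((hasDerivAt_id' τ).const_mul (2 + K))).exp.congr_deriv ?_
    simp only [hE, hμ]
    field_simp
    ring
  have hμc : Continuous μ := continuous_iff_continuousAt.2 fun τ => (hμd τ).continuousAt
  have hEc : Continuous E := continuous_iff_continuousAt.2 fun τ => (hEd τ).continuousAt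
  obtain ⟨E₁, hE₁⟩ := (isCompact_Icc (a := (0 : ℝ)) (b := 1)).bddAbove_image hEc.continuousOn
  have hE₁' : ∀ τ ∈ Icc (0 : ℝ) 1, E τ ≤ E₁ := fun τ hτ => hE₁ (mem_image_of_mem E hτ)
  have hmem {τ : ℝ} (hτ : τ ∈ Ioc s 1) : τ ∈ Icc (0 : ℝ) 1 := ⟨hs.1.trans hτ.1.le, hτ.2⟩
  have hαsum (τ : ℝ) : HasSum (fun i => E τ * (1 / 2 * ⟪e i, F τ⟫ ^ 2 - K * ⟪e i, w τ⟫ ^ 2))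
      (E τ * (1 / 2 * ‖F τ‖ ^ 2 - K * ‖w τ‖ ^ 2)) :=
    (((e.hasSum_inner_sq _).mul_left _).sub ((e.hasSum_inner_sq _).mul_left _)).mul_left _
  have hdecay := hw.eventually_weighted_sum_le hs.1 hs.2 le_rfl
    (p := fun i τ => E τ * (lam i - μ τ))
    (p' := fun i τ => E τ * (2 * μ τ - K) * (lam i - μ τ) + E τ * -(K * (μ τ + 1)))
    (α := fun i τ => E τ * (1 / 2 * ⟪e i, F τ⟫ ^ 2 - K * ⟪e i, w τ⟫ ^ 2))
    (β := fun i τ => E τ * (K * (lam i * ⟪e i, w τ⟫ ^ 2)))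
    (fun i τ => (hEd τ).mul ((hμd τ).const_sub (lam i)))
    (fun i => by fun_prop)
    (fun i τ _ => by
      -- The square completed in the termwise bound of the cross term with `F`.
      have hsq : 0 ≤ E τ * (1 / 2 * (2 * (lam i - μ τ) * ⟪e i, w τ⟫ - ⟪e i, F τ⟫) ^ 2) := by
        have := hEpos τ
        positivity
      linarith)
    (fun τ _ => (hαsum τ).summable)
    (fun i τ _ => mul_nonneg (hEpos τ).le
      (mul_nonneg hK.le (mul_nonneg (hlam i) (sq_nonneg _))))
    (G := E₁ * (1 / 2 * B ^ 2))
    (fun τ hτ N => by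
      rw [← Finset.mul_sum, Finset.sum_sub_distrib, ← Finset.mul_sum, ← Finset.mul_sum]
      have h1 : ∑ i ∈ Finset.range N, ⟪e i, F τ⟫ ^ 2 ≤ B ^ 2 :=
        (e.sum_inner_sq_le _ _).trans (pow_le_pow_left₀ (norm_nonneg _) (hB τ (hmem hτ)) 2)
      have h2 : 0 ≤ K * ∑ i ∈ Finset.range N, ⟪e i, w τ⟫ ^ 2 := by positivity
      calc _ ≤ E τ * (1 / 2 * B ^ 2) := by
            refine mul_le_mul_of_nonneg_left ?_ (hEpos τ).le
            linarith
        _ ≤ _ := by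
            gcongr
            exact hE₁' τ (hmem hτ))
    (fun τ hτ hβ => by
      have hne : E τ * K ≠ 0 := (mul_pos (hEpos τ) hK).ne'
      have hs1 : Summable fun i => lam i * ⟪e i, w τ⟫ ^ 2 := by
        rw [← summable_mul_left_iff hne]
        simpa only [mul_assoc] using hβ
      rw [(hαsum τ).tsum_eq, tsum_mul_left, tsum_mul_left]
      refine mul_le_mul_of_nonneg_left ?_ (hEpos τ).le
      linarith [hF τ (hmem hτ) hs1])
    (ε := E 1 * ε / 2) (by have := hEpos 1; positivity)
  have hinit : HasSum (fun i => E s * (lam i - μ s) * ⟪e i, w s⟫ ^ 2)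
      (E s * ((∑' i, lam i * ⟪e i, w s⟫ ^ 2) - μ s * ‖w s‖ ^ 2)) := by
    have := (hsum.hasSum.sub ((e.hasSum_inner_sq (w s)).mul_left (μ s))).mul_left (E s)
    refine this.congr_fun fun i => ?_
    ring
  have hinit' := hinit.tendsto_sum_nat.eventually_le_const (u := E 1 * ε / 2) (by
    refine lt_of_le_of_lt (mul_nonpos_of_nonneg_of_nonpos (hEpos s).le (by linarith)) ?_
    have := hEpos 1
    positivity)
  have hμ1 : μ 1 = ν := by simp [hμ]
  filter_upwards [hdecay, hinit'] with N h1 h2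
  simp only [hμ1, mul_assoc, ← Finset.mul_sum] at h1 h2
  refine le_of_mul_le_mul_left ?_ (hEpos 1)
  linarith

/-- Exponential decay of `‖w‖²`, by the energy balance, as long as the energy dominates. -/
lemma IsModalSolution.norm_sq_le_of_energy (hw : IsModalSolution e lam w F)
    (hlam : ∀ i, 0 ≤ lam i) {c : ℝ} (hmono : ∀ τ ∈ Icc (0 : ℝ) 1, ⟪F τ, w τ⟫ ≤ c * ‖w τ‖ ^ 2)
    (henergy : ∀ τ ∈ Icc (0 : ℝ) 1, (Summable fun i => lam i * ⟪e i, w τ⟫ ^ 2) →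
      (c + 1 / 2) * ‖w τ‖ ^ 2 ≤ ∑' i, lam i * ⟪e i, w τ⟫ ^ 2) :
    Real.exp 1 * ‖w 1‖ ^ 2 ≤ ‖w 0‖ ^ 2 := by
  obtain ⟨B, hB⟩ := hw.bounded
  obtain ⟨W, hW⟩ := (isCompact_Icc (a := (0 : ℝ)) (b := 1)).bddAbove_image
    hw.continuousOn.norm
  have hW' : ∀ τ ∈ Icc (0 : ℝ) 1, ‖w τ‖ ≤ W := fun τ hτ => hW (mem_image_of_mem _ hτ)
  have hαsum (τ : ℝ) : HasSum
      (fun i => Real.exp τ * (⟪e i, w τ⟫ ^ 2 + 2 * (⟪e i, F τ⟫ * ⟪e i, w τ⟫)))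
      (Real.exp τ * (‖w τ‖ ^ 2 + 2 * ⟪F τ, w τ⟫)) := by
    have h := e.hasSum_inner_mul_inner (F τ) (w τ)
    simp only [real_inner_comm _ (F τ)] at h
    rw [real_inner_comm] at h
    exact ((e.hasSum_inner_sq _).add (h.mul_left 2)).mul_left _
  refine le_of_forall_pos_le_add fun ε hε => ?_
  have hdecay := hw.eventually_weighted_sum_le le_rfl zero_le_one le_rfl
    (p := fun _ τ => Real.exp τ) (p' := fun _ τ => Real.exp τ)
    (α := fun i τ => Real.exp τ * (⟪e i, w τ⟫ ^ 2 + 2 * (⟪e i, F τ⟫ * ⟪e i, w τ⟫)))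
    (β := fun i τ => Real.exp τ * 2 * (lam i * ⟪e i, w τ⟫ ^ 2))
    (fun _ τ => Real.hasDerivAt_exp τ) (fun _ => Real.continuous_exp)
    (fun i τ _ => le_of_eq (by ring))
    (fun τ _ => (hαsum τ).summable)
    (fun i τ _ => mul_nonneg (by positivity) (mul_nonneg (hlam i) (sq_nonneg _)))
    (G := Real.exp 1 * (2 * W ^ 2 + B ^ 2))
    (fun τ hτ N => by
      have hτ' := Ioc_subset_Icc_self hτ
      have h1 : ∑ i ∈ Finset.range N, ⟪e i, F τ⟫ ^ 2 ≤ B ^ 2 :=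
        (e.sum_inner_sq_le _ _).trans (pow_le_pow_left₀ (norm_nonneg _) (hB τ hτ') 2)
      have h2 : ∑ i ∈ Finset.range N, ⟪e i, w τ⟫ ^ 2 ≤ W ^ 2 :=
        (e.sum_inner_sq_le _ _).trans (pow_le_pow_left₀ (norm_nonneg _) (hW' τ hτ') 2)
      have h3 : ∑ i ∈ Finset.range N, (⟪e i, w τ⟫ ^ 2 + 2 * (⟪e i, F τ⟫ * ⟪e i, w τ⟫)) ≤
          ∑ i ∈ Finset.range N, (2 * ⟪e i, w τ⟫ ^ 2 + ⟪e i, F τ⟫ ^ 2) :=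
        Finset.sum_le_sum fun i _ => by
          linarith [sq_nonneg (⟪e i, F τ⟫ - ⟪e i, w τ⟫)]
      rw [Finset.sum_add_distrib (f := fun i => 2 * ⟪e i, w τ⟫ ^ 2), ← Finset.mul_sum] at h3
      rw [← Finset.mul_sum]
      have h4 : Real.exp τ ≤ Real.exp 1 := Real.exp_le_exp.2 hτ.2
      calc _ ≤ Real.exp τ * (2 * W ^ 2 + B ^ 2) := by gcongr; linarith
        _ ≤ _ := by gcongr)
    (fun τ hτ hβ => by
      have hs1 : Summable fun i => lam i * ⟪e i, w τ⟫ ^ 2 := by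
        rwa [summable_mul_left_iff (by positivity)] at hβ
      have hτ' := Ioc_subset_Icc_self hτ
      rw [(hαsum τ).tsum_eq, tsum_mul_left, mul_assoc]
      refine mul_le_mul_of_nonneg_left ?_ (Real.exp_pos τ).le
      linarith [henergy τ hτ' hs1, hmono τ hτ'])
    hε
  simp only [Real.exp_zero, one_mul, ← Finset.mul_sum] at hdecay
  exact le_of_tendsto_of_tendsto ((e.hasSum_inner_sq (w 1)).tendsto_sum_nat.const_mul _)
    ((e.hasSum_inner_sq (w 0)).tendsto_sum_nat.add_const ε) hdecay

/-- If `w` lies outside the cone `‖(1 - P) w‖ ≤ ‖P w‖` at the final time, then its energy is large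
there, hence at all times, and `w` decays. -/
lemma IsModalSolution.squeezing (hw : IsModalSolution e lam w F) (hlam : ∀ i, 0 ≤ lam i)
    (hmon : Monotone lam) {K c : ℝ} (hK : 0 < K) (hc : 0 ≤ c)
    (hF : ∀ τ ∈ Icc (0 : ℝ) 1, (Summable fun i => lam i * ⟪e i, w τ⟫ ^ 2) →
      ‖F τ‖ ^ 2 ≤ 2 * K * ((∑' i, lam i * ⟪e i, w τ⟫ ^ 2) + ‖w τ‖ ^ 2))
    (hmono : ∀ τ ∈ Icc (0 : ℝ) 1, ⟪F τ, w τ⟫ ≤ c * ‖w τ‖ ^ 2)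
    {m : ℕ} (hm : (c + 3 / 2) * Real.exp K ≤ lam m / 2 + 1) :
    ‖w 1‖ ≤ Real.exp (-(1 / 2)) * ‖w 0‖ ∨
      ‖(1 - spectralProj e m) (w 1)‖ ≤ ‖spectralProj e m (w 1)‖ := by
  have hν : 0 < lam m / 2 := by
    have h1 : 1 ≤ Real.exp K := Real.one_le_exp hK.le
    nlinarith
  by_cases hcone : ∃ s ∈ Icc (0 : ℝ) 1, (Summable fun i => lam i * ⟪e i, w s⟫ ^ 2) ∧
      ∑' i, lam i * ⟪e i, w s⟫ ^ 2 ≤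
        ((lam m / 2 + 1) * Real.exp (K * (s - 1)) - 1) * ‖w s‖ ^ 2
  · right
    obtain ⟨s, hs, hsum, hle⟩ := hcone
    refine le_of_sq_le_sq ?_ (norm_nonneg _)
    rw [norm_one_sub_spectralProj_sq, norm_spectralProj_sq]
    set q := ∑ i ∈ Finset.range m, ⟪e i, w 1⟫ ^ 2 with hq
    have hlow (N : ℕ) (hN : m ≤ N) : lam m / 2 * (∑ i ∈ Finset.range N, ⟪e i, w 1⟫ ^ 2 - 2 * q) ≤
        ∑ i ∈ Finset.range N, (lam i - lam m / 2) * ⟪e i, w 1⟫ ^ 2 := by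
      rw [← Finset.sum_range_add_sum_Ico _ hN, ← Finset.sum_range_add_sum_Ico _ hN, ← hq]
      have h1 : ∑ i ∈ Finset.range m, -(lam m / 2) * ⟪e i, w 1⟫ ^ 2 ≤
          ∑ i ∈ Finset.range m, (lam i - lam m / 2) * ⟪e i, w 1⟫ ^ 2 :=
        Finset.sum_le_sum fun i _ =>
          mul_le_mul_of_nonneg_right (by linarith [hlam i]) (sq_nonneg _)
      have h2 : ∑ i ∈ Finset.Ico m N, lam m / 2 * ⟪e i, w 1⟫ ^ 2 ≤
          ∑ i ∈ Finset.Ico m N, (lam i - lam m / 2) * ⟪e i, w 1⟫ ^ 2 :=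
        Finset.sum_le_sum fun i hi => mul_le_mul_of_nonneg_right
          (by linarith [hmon (Finset.mem_Ico.1 hi).1]) (sq_nonneg _)
      rw [← Finset.mul_sum] at h1 h2
      rw [← hq] at h1
      linarith
    have hlim := (((e.hasSum_inner_sq (w 1)).tendsto_sum_nat.sub_const (2 * q)).const_mul
      (lam m / 2))
    have h0 : lam m / 2 * (‖w 1‖ ^ 2 - 2 * q) ≤ 0 := by
      refine le_of_forall_pos_le_add fun ε hε => ?_
      rw [zero_add]
      refine le_of_tendsto hlim ?_
      filter_upwards [hw.eventually_cone hlam hK hF hs hsum hle hε, eventually_ge_atTop m]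
        with N h1 h2
      exact (hlow N h2).trans h1
    have := nonpos_of_mul_nonpos_right h0 hν
    linarith
  · left
    push Not at hcone
    have h := hw.norm_sq_le_of_energy hlam hmono fun τ hτ hs => by
      refine le_trans (mul_le_mul_of_nonneg_right ?_ (sq_nonneg _)) (hcone τ hτ hs).le
      have h1 : Real.exp (-K) ≤ Real.exp (K * (τ - 1)) :=
        Real.exp_le_exp.2 (by nlinarith [hτ.1])
      have h2 : c + 3 / 2 ≤ (lam m / 2 + 1) * Real.exp (-K) := by
        rw [Real.exp_neg, ← div_eq_mul_inv, le_div_iff₀ (Real.exp_pos K)]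
        exact hm
      have h3 := mul_le_mul_of_nonneg_left h1 (by linarith : 0 ≤ lam m / 2 + 1)
      linarith
    refine le_of_sq_le_sq ?_ (by positivity)
    rw [mul_pow, ← Real.exp_nat_mul]
    have h2 : Real.exp (((2 : ℕ) : ℝ) * -(1 / 2)) * Real.exp 1 = 1 := by
      rw [← Real.exp_add]; norm_num
    calc ‖w 1‖ ^ 2 = Real.exp (((2 : ℕ) : ℝ) * -(1 / 2)) * (Real.exp 1 * ‖w 1‖ ^ 2) := by
          rw [← mul_assoc, h2, one_mul]
      _ ≤ _ := by gcongr

end Modal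

/-! ### The difference of two trajectories -/

section Difference

variable {d : ℕ} {Ω : Set (Euc d)}

open Classical in
/-- The difference `f(u) - f(v)` of the pointwise nonlinearities as an element of `L²`, and `0` if
it is not square integrable. -/
def nonlinDiff (f : Euc d → Euc d) (u v : L2 Ω) : L2 Ω :=
  if h : MemLp (fun x => f (u x) - f (v x)) 2 (volume.restrict Ω) then h.toLp _ else 0

variable {f : Euc d → Euc d} {M : Set (L2 Ω)} {C Cstar : ℝ} {u v : L2 Ω}

lemma LipschitzEH.memLp (hLip : LipschitzEH f M C) (hf : Continuous f) (hu : u ∈ M) (hv : v ∈ M) :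
    MemLp (fun x => f (u x) - f (v x)) 2 (volume.restrict Ω) :=
  ⟨(hf.comp_aestronglyMeasurable (Lp.aestronglyMeasurable u)).sub
    (hf.comp_aestronglyMeasurable (Lp.aestronglyMeasurable v)),
    (hLip u hu v hv).trans_lt ENNReal.ofReal_lt_top⟩

lemma LipschitzEH.norm_nonlinDiff_le (hLip : LipschitzEH f M C) (hC : 0 ≤ C) (hf : Continuous f)
    (hu : u ∈ M) (hv : v ∈ M) : ‖nonlinDiff f u v‖ ≤ C * normE (u - v) := by
  rw [nonlinDiff, dif_pos (hLip.memLp hf hu hv), Lp.norm_toLp]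
  exact ENNReal.toReal_le_of_le_ofReal (mul_nonneg hC (normE_nonneg _)) (hLip u hu v hv)

lemma LipschitzEH.coeFn_nonlinDiff (hLip : LipschitzEH f M C) (hf : Continuous f)
    (hu : u ∈ M) (hv : v ∈ M) :
    nonlinDiff f u v =ᵐ[volume.restrict Ω] fun x => f (u x) - f (v x) := by
  rw [nonlinDiff, dif_pos (hLip.memLp hf hu hv)]
  exact MemLp.coeFn_toLp _

lemma LipschitzEH.inner_nonlinDiff_sub_le (hLip : LipschitzEH f M C) (hf : Continuous f)
    (hmono : OneSidedMonotone f M Cstar) (hu : u ∈ M) (hv : v ∈ M) :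
    ⟪nonlinDiff f u v, u - v⟫ ≤ Cstar * ‖u - v‖ ^ 2 := by
  refine le_of_eq_of_le ?_ (hmono u hu v hv)
  rw [L2.inner_def]
  refine integral_congr_ae ?_
  filter_upwards [hLip.coeFn_nonlinDiff hf hu hv, Lp.coeFn_sub u v] with x h1 h2
  rw [h1, h2, Pi.sub_apply]

lemma LipschitzEH.inner_nonlinDiff (hLip : LipschitzEH f M C) (hf : Continuous f)
    (hu : u ∈ M) (hv : v ∈ M) {ζ : L2 Ω} (hiu : IntegrableOn (fun x => ⟪f (u x), ζ x⟫) Ω)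
    (hiv : IntegrableOn (fun x => ⟪f (v x), ζ x⟫) Ω) :
    ⟪ζ, nonlinDiff f u v⟫ = (∫ x in Ω, ⟪f (u x), ζ x⟫) - ∫ x in Ω, ⟪f (v x), ζ x⟫ := by
  rw [real_inner_comm, L2.inner_def, ← integral_sub hiu hiv]
  refine integral_congr_ae ?_
  filter_upwards [hLip.coeFn_nonlinDiff hf hu hv] with x h1
  rw [h1, inner_sub_left]

/-- The difference of two weak solutions in `M` solves a linear equation with right-hand side
`f(g) - f(h)`, coordinatewise in the eigenbasis. -/
lemma IsWeakSolution.isModalSolution_sub (hΩ : IsOpen Ω) (hf : Continuous f)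
    {A : L2 Ω →ₗ.[ℝ] L2 Ω} {e : HilbertBasis ℕ ℝ (L2 Ω)} {lam : ℕ → ℝ}
    (he : IsOrderedEigenbasis A e lam) {g h : ℝ → L2 Ω} (hg : IsWeakSolution A f g)
    (hh : IsWeakSolution A f h) (hM : IsClosedBoundedInE M) (hgM : ∀ t, 0 ≤ t → g t ∈ M)
    (hhM : ∀ t, 0 ≤ t → h t ∈ M) (hC : 0 ≤ C) (hLip : LipschitzEH f M C) :
    IsModalSolution e lam (fun t => g t - h t) (fun t => nonlinDiff f (g t) (h t)) := by
  choose hd hA using he.eigen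
  have hpair (i : ℕ) (t : ℝ) : (fun s => ⟪e i, nonlinDiff f (g s) (h s)⟫)
      =ᵐ[volume.restrict (Ioc 0 t)] fun s =>
        (∫ x in Ω, ⟪f (g s x), e i x⟫) - ∫ x in Ω, ⟪f (h s x), e i x⟫ := by
    filter_upwards [ae_restrict_of_ae_restrict_of_subset Ioc_subset_Ioi_self
      (hg.pairing_integrable ⟨e i, hd i⟩), ae_restrict_of_ae_restrict_of_subset Ioc_subset_Ioi_self
      (hh.pairing_integrable ⟨e i, hd i⟩), ae_restrict_mem measurableSet_Ioc] with s h1 h2 h3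
    exact hLip.inner_nonlinDiff hf (hgM s h3.1.le) (hhM s h3.1.le) h1 h2
  have hint {k : ℝ → L2 Ω} (hk : IsWeakSolution A f k) (i : ℕ) {t : ℝ} (ht : t ∈ Icc (0 : ℝ) 1) :
      IntervalIntegrable (fun s => -⟪k s, A ⟨e i, hd i⟩⟫ + ∫ x in Ω, ⟪f (k s x), e i x⟫)
        volume 0 t := by
    have hc : ContinuousOn (fun s => -⟪k s, A ⟨e i, hd i⟩⟫) (uIcc 0 1) := by
      rw [uIcc_of_le zero_le_one]
      exact ((hk.continuousOn.mono Icc_subset_Ici_self).inner continuousOn_const).neg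
    refine IntervalIntegrable.mono_set (hc.intervalIntegrable.add
      (hk.pairing_locallyIntegrable ⟨e i, hd i⟩ 1 one_pos)) ?_
    rw [uIcc_of_le ht.1, uIcc_of_le zero_le_one]
    exact Icc_subset_Icc_right ht.2
  refine ⟨?_, fun i => ?_, fun i t ht => ?_, ?_⟩
  · exact (hg.continuousOn.sub hh.continuousOn).mono Icc_subset_Ici_self
  · have := (hg.pairing_locallyIntegrable ⟨e i, hd i⟩ 1 one_pos).sub
      (hh.pairing_locallyIntegrable ⟨e i, hd i⟩ 1 one_pos)
    refine this.congr_ae ?_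
    rw [uIoc_of_le zero_le_one]
    exact (hpair i 1).symm
  · have h1 := hg.equation ⟨e i, hd i⟩ t ht.1
    have h2 := hh.equation ⟨e i, hd i⟩ t ht.1
    have h3 := intervalIntegral.integral_sub (hint hg i ht) (hint hh i ht)
    have h4 : ∫ s in (0 : ℝ)..t, ((-⟪g s, A ⟨e i, hd i⟩⟫ + ∫ x in Ω, ⟪f (g s x), e i x⟫) -
        (-⟪h s, A ⟨e i, hd i⟩⟫ + ∫ x in Ω, ⟪f (h s x), e i x⟫)) =
        ∫ s in (0 : ℝ)..t,
          (-(lam i * ⟪e i, g s - h s⟫) + ⟪e i, nonlinDiff f (g s) (h s)⟫) := by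
      refine intervalIntegral.integral_congr_ae_restrict ?_
      rw [uIoc_of_le ht.1]
      filter_upwards [hpair i t] with s hs
      rw [hs, hA, inner_smul_right, inner_smul_right, inner_sub_right, real_inner_comm (e i),
        real_inner_comm (e i)]
      ring
    rw [← h4, h3, ← h1, ← h2]
    simp only [inner_sub_right, real_inner_comm (e i)]
    ring
  · obtain ⟨R, hR⟩ := hM.bounded
    refine ⟨C * √((d + 1) * (2 * R) ^ 2), fun t ht => ?_⟩
    have h1 := hgM t ht.1
    have h2 := hhM t ht.1
    refine (hLip.norm_nonlinDiff_le hC hf h1 h2).trans ?_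
    gcongr
    exact Real.le_sqrt_of_sq_le (normE_sub_sq_le hΩ (hM.subset_E _ h1) (hM.subset_E _ h2)
      (hR _ h1) (hR _ h2))

end Difference

end

theorem theorem2p1 {d : ℕ} (hd : 3 ≤ d) (Ω : Set (Euc d)) (hΩ : IsBoundedLipschitzDomain Ω)
    (f : Euc d → Euc d) (hf : ContDiff ℝ 1 f)
    (A : L2 Ω →ₗ.[ℝ] L2 Ω) (hA : IsNonnegSelfAdjointCompactResolvent A)
    (hAE : EnergyControlsE A)
    (e : HilbertBasis ℕ ℝ (L2 Ω)) (lam : ℕ → ℝ) (he : IsOrderedEigenbasis A e lam)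
    (S : ℝ → L2 Ω → L2 Ω) (hS : IsSolutionSemiflow A f S)
    (M : Set (L2 Ω)) (hM : IsClosedBoundedInE M) (hMinv : PositivelyInvariant S M)
    (C : ℝ) (hC : 0 < C) (hLip : LipschitzEH f M C)
    (Cstar : ℝ) (hCstar : 0 < Cstar) (hmono : OneSidedMonotone f M Cstar) :
    ∃ m₀ : ℕ, 1 ≤ m₀ ∧ ∀ m : ℕ, m₀ ≤ m →
      SqueezingProperty S 1 (spectralProj e m) M := by
  obtain ⟨κ, hκ⟩ := hAE
  have hlam := he.eigenvalue_nonneg hA.nonneg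
  -- The growth rate of the cone slope; the summand `1` only makes it positive.
  set K : ℝ := C ^ 2 * |κ| / 2 + 1 with hKdef
  have hK : 0 < K := by positivity
  obtain ⟨m₁, hm₁⟩ := eventually_atTop.1 ((he.tendsto_eigenvalue_atTop
    hA.compactResolvent).eventually_ge_atTop (2 * ((Cstar + 3 / 2) * Real.exp K - 1)))
  refine ⟨max 1 m₁, le_max_left _ _, fun m hm => ⟨one_pos, hMinv, isStarProjection_spectralProj e m,
    finiteDimensional_range_spectralProj e m, Real.exp (-(1 / 2)), Real.exp_pos _,
    Real.exp_lt_one_iff.2 (by norm_num), fun u hu v hv => ?_⟩⟩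
  have hw := (hS.isWeakSolution u).isModalSolution_sub hΩ.isOpen hf.continuous he
    (hS.isWeakSolution v) hM (fun t ht => hMinv t ht hu) (fun t ht => hMinv t ht hv) hC.le hLip
  have key := hw.squeezing hlam he.mono hK hCstar.le
    (fun τ hτ hsum => by
      have h1 := hLip.norm_nonlinDiff_le hC.le hf.continuous (hMinv τ hτ.1 hu) (hMinv τ hτ.1 hv)
      have h2 := normE_sq_le_of_summable hΩ.isOpen he hlam (abs_nonneg κ)
        (fun x => ⟨(hκ x).1, (hκ x).2.trans (mul_le_mul_of_nonneg_right (le_abs_self κ)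
          (add_nonneg (hA.nonneg x) (sq_nonneg _)))⟩) _ hsum
      have h3 : 0 ≤ (∑' i, lam i * ⟪e i, S τ u - S τ v⟫ ^ 2) + ‖S τ u - S τ v‖ ^ 2 :=
        add_nonneg (tsum_nonneg fun i => mul_nonneg (hlam i) (sq_nonneg _)) (sq_nonneg _)
      calc _ ≤ (C * normE (S τ u - S τ v)) ^ 2 := pow_le_pow_left₀ (norm_nonneg _) h1 2
        _ = C ^ 2 * normE (S τ u - S τ v) ^ 2 := by ring
        _ ≤ C ^ 2 * (|κ| * _) := mul_le_mul_of_nonneg_left h2 (sq_nonneg C)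
        _ ≤ _ := by
          rw [← mul_assoc]
          refine mul_le_mul_of_nonneg_right ?_ h3
          rw [hKdef]
          linarith)
    (fun τ hτ => hLip.inner_nonlinDiff_sub_le hf.continuous hmono
      (hMinv τ hτ.1 hu) (hMinv τ hτ.1 hv))
    (m := m) (by linarith [hm₁ m ((le_max_right _ _).trans hm)])
  simpa only [hS.zero] using key
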